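/- Let $\mu$ be a probability measure on a countable group $G$ with identity $e$, with finite Shannon entropy $H(\mu)=-\sum_g\mu(g)\log\mu(g)<\infty$. Let $\mathbb P$ be the law on $G^{\mathbb N}$ of the $\mu$-random walk $w_0=e$, $w_n=g_1\cdots g_n$, with $g_1,g_2,\dots$ i.i.d. of law $\mu$. Let $\mathbf X=(X,\nu)$ be a $\mu$-boundary of $G$: a standard Borel probability space with a measurable $G$-action and a measurable boundary map $\boldsymbol\xi:G^{\mathbb N}\to X$ with $\boldsymbol\xi_*\mathbb P=\nu$ which is, almost surely for the walk started at any point of $G$, invariant under the time shift and $G$-equivariant. Let $\mathbb P=\int_X\mathbb P^\xi\,d\nu(\xi)$ be the disintegration of $\mathbb P$ over $\boldsymbol\xi$. For $n\ge 0$ put $$H_{\mathbf X}(\alpha_n)=\int_X\Big(-\sum_{g\in G}\mathbb P^\xi[w_n=g]\log\mathbb P^\xi[w_n=g]\Big)d\nu(\xi).$$ A *collection of length $n$* is a tuple $q=(\mathbf x,i_1,\dots,i_k)$ with integers $0<i_1<\dots<i_k\le n$ and $\mathbf x=(x_l)_{l\in\{1,\dots,n\}\setminus\{i_1,\dots,i_k\}}$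 a tuple of elements of $\operatorname{supp}(\mu)$. For $a,b\in\operatorname{supp}(\mu)$ let $T^{a,b}(q)$ be the set of $\mathbf y=(y_1,\dots,y_n)\in G^n$ such that, with $y_0=e$, one has $y_l=y_{l-1}x_l$ for $l\notin\{i_1,\dots,i_k\}$ and $y_l\in\{y_{l-1}a,\,y_{l-1}b\}$ for $l\in\{i_1,\dots,i_k\}$. It is *satisfactory* if $y_n\ne y_n'$ for all distinct $\mathbf y,\mathbf y'\in T^{a,b}(q)$. Let $[\mathbf y]=\{\mathbf w\in G^{\mathbb N}: w_j=y_j,\ 1\le j\le n\}$. Let $a\in G\setminus\{e\}$ be such that $a,e\in\operatorname{supp}(\mu)$, and let $J\subseteq X$ be a measurable set such that $a(x)=x$ for all $x\in X\setminus J$. Suppose that there are $p,c>0$, for each $n\ge 1$ a measurable set $\Xi_n\subseteq X$ with $\nu(\Xi_n)\ge p$, and for $\nu$-almost every $\xi\in\Xi_n$ a set $A_{n,\xi}$ of collections of length $n$ such that: 1. for each $q=(\mathbf x,i_1,\dots,i_k)\in A_{n,\xi}$ we have $k\ge cn$; 2. for each $q\in A_{n,\xi}$ the set $T^{a,e}(q)$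 is satisfactory; 3. for all $q_1\neq q_2$ in $A_{n,\xi}$, $\mathbf y_1\in T^{a,e}(q_1)$ and $\mathbf y_2\in T^{a,e}(q_2)$ we have $[\mathbf y_1]\cap[\mathbf y_2]=\emptyset$; 4. $\mathbb P^\xi\Big[\bigcup_{q\in A_{n,\xi}}\bigcup_{\mathbf y\in T^{a,e}(q)}[\mathbf y]\Big]\ge p$; 5. for each $q=(\mathbf x,i_1,\dots,i_k)\in A_{n,\xi}$, each $(y_1,\dots,y_n)\in T^{a,e}(q)$ and each $1\le r\le k$ we have $y_{i_r-1}^{-1}(\xi)\notin J$. Then the limit $h(\mu\mid\mathbf X)=\lim_{n\to\infty}H_{\mathbf X}(\alpha_n)/n$ exists, is finite, and is positive. -/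

import Mathlib

open MeasureTheory ProbabilityTheory Filter Topology

namespace RandomWalk

/-- The trajectory `(e, g₁, g₁g₂, …)` with increments `g₁, g₂, …`; the increment at time `n + 1`
is `g n`. -/
def path {G : Type*} [Group G] (g : ℕ → G) : ℕ → G
  | 0 => 1
  | n + 1 => path g n * g n

/-- The law `ℙ` on the space `G^ℕ` of trajectories of the (right) `μ`-random walk started at the
identity. -/
noncomputable def law {G : Type*} [Group G] [MeasurableSpace G] (μ : Measure G)
    [IsProbabilityMeasure μ] : Measure (ℕ → G) :=
  (Measure.infinitePi (fun _ : ℕ => μ)).map path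

/-- The shift `(w₀, w₁, …) ↦ (w₁, w₂, …)`. -/
def shift {G : Type*} (w : ℕ → G) : ℕ → G := fun n => w (n + 1)

/-- `(X, ν)` is a `μ`-boundary with boundary map `bnd`. Shift invariance and equivariance hold
almost surely for the walk started at any point `g`, whose law is that of `n ↦ g * w n` with
`w` distributed according to `ℙ`. -/
structure IsBoundary {G : Type*} [Group G] [MeasurableSpace G] (μ : Measure G)
    [IsProbabilityMeasure μ] {X : Type*} [MeasurableSpace X] [MulAction G X]
    (ν : Measure X) (bnd : (ℕ → G) → X) : Prop where
  measurable : Measurable bnd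
  map_eq : (law μ).map bnd = ν
  shift_invariant : ∀ g : G, ∀ᵐ w ∂(law μ), bnd (shift fun n => g * w n) = bnd fun n => g * w n
  equivariant : ∀ g : G, ∀ᵐ w ∂(law μ), bnd (fun n => g * w n) = g • bnd w

/-- The conditional measures `ℙ^ξ` of the disintegration of `ℙ` over the boundary map. -/
noncomputable def condLaw {G : Type*} [Group G] [Countable G] [MeasurableSpace G]
    [DiscreteMeasurableSpace G] (μ : Measure G) [IsProbabilityMeasure μ]
    {X : Type*} [MeasurableSpace X] (bnd : (ℕ → G) → X) : Kernel X (ℕ → G) :=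
  haveI : IsProbabilityMeasure (law μ) := by
    refine Measure.isProbabilityMeasure_map (Measurable.aemeasurable ?_)
    refine measurable_pi_lambda _ fun n => ?_
    induction n with
    | zero => exact measurable_const
    | succ n ih => exact ih.mul (measurable_pi_apply n)
  condDistrib id bnd (law μ)

/-- Shannon entropy `-∑ m(s) log m(s)`, in `[0, ∞]`, of a probability measure `m` on a countable
set; equivalently, of the partition of this set into points. -/
noncomputable def shannonEntropy {S : Type*} [MeasurableSpace S] (m : Measure S) : ENNReal :=
  ∑' s : S, ENNReal.ofReal (Real.negMulLog (m.real {s}))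

/-- The conditional entropy `H_ξ(α_n) = -∑ ℙ^ξ(w_n = g) log ℙ^ξ(w_n = g)`, in `[0, ∞]`, of the
partition `α_n` of the space of trajectories according to the position at time `n`. -/
noncomputable def condEntropy {G : Type*} [Group G] [Countable G] [MeasurableSpace G]
    [DiscreteMeasurableSpace G] (μ : Measure G) [IsProbabilityMeasure μ]
    {X : Type*} [MeasurableSpace X] (bnd : (ℕ → G) → X) (n : ℕ) (ξ : X) : ENNReal :=
  ∑' g : G, ENNReal.ofReal (Real.negMulLog ((condLaw μ bnd ξ).real {w | w n = g}))

/-- The mean conditional entropy `H_𝐗(α_n) = ∫ H_ξ(α_n) dν(ξ)`, in `[0, ∞]`. -/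
noncomputable def meanCondEntropy {G : Type*} [Group G] [Countable G] [MeasurableSpace G]
    [DiscreteMeasurableSpace G] (μ : Measure G) [IsProbabilityMeasure μ]
    {X : Type*} [MeasurableSpace X] (ν : Measure X) (bnd : (ℕ → G) → X) (n : ℕ) : ENNReal :=
  ∫⁻ ξ, condEntropy μ bnd n ξ ∂ν

/-- A collection `(𝐱, i₁, …, i_k)` of length `n`. The index `j : Fin n` stands for the time
`j + 1`, so `times` is `{i₁ < ⋯ < i_k} ⊆ {1, …, n}`, and `step` is the tuple `𝐱` of elements of
the support of `μ`, indexed by the other times. -/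
structure Collection {G : Type*} [MeasurableSpace G] (μ : Measure G) (n : ℕ) where
  times : Finset (Fin n)
  step : {j : Fin n // j ∉ times} → G
  step_mem : ∀ j, μ {step j} ≠ 0

namespace Collection

/-- The set `T^{a,b}(q)` of trajectories `(y₀ = e, y₁, …, y_n)`. For the index `j : Fin n` of the
time `j + 1`, the positions before and after the step are `y j.castSucc` and `y j.succ`. -/
def trajectories {G : Type*} [Group G] [MeasurableSpace G] {μ : Measure G} {n : ℕ} (a b : G)
    (q : Collection μ n) : Set (Fin (n + 1) → G) :=
  {y | y 0 = 1 ∧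
    (∀ j : {j : Fin n // j ∉ q.times}, y j.1.succ = y j.1.castSucc * q.step j) ∧
    ∀ j ∈ q.times, y j.succ = y j.castSucc * a ∨ y j.succ = y j.castSucc * b}

/-- Distinct trajectories in `T^{a,b}(q)` arrive at different elements at time `n`. -/
def Satisfactory {G : Type*} [Group G] [MeasurableSpace G] {μ : Measure G} {n : ℕ} (a b : G)
    (q : Collection μ n) : Prop :=
  ∀ y ∈ q.trajectories a b, ∀ y' ∈ q.trajectories a b, y ≠ y' → y (Fin.last n) ≠ y' (Fin.last n)

end Collection

/-- The cylinder `[𝐲] = {𝐰 | w_j = y_j for 1 ≤ j ≤ n}`. -/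
def cylinder {G : Type*} {n : ℕ} (y : Fin (n + 1) → G) : Set (ℕ → G) :=
  {w | ∀ j : Fin n, w (j + 1) = y j.succ}

end RandomWalk

namespace RandomWalk

/-! Existence of the limit: conditioned on `ξ`, the walk is again Markov, and after reaching `h` at
time `n` it continues as the walk conditioned on `h⁻¹ • ξ` (`IsBoundary.ae_condLaw_add`). Since
`ℙ^ξ(w_n = h) dν(ξ)` is `ℙ(w_n = h)` times the image of `ν` under `h`, averaging over `ξ` makes the
mean conditional entropy subadditive. At time 1 it is at most `H(μ)` by Jensen, so Fekete's lemma
applies.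

Positivity: fix `ξ` and a collection `q` with `k` choices. Each choice between `a` and `e` is made
where `a` fixes the translated boundary point, so all trajectories of `q` see the same translate of
`ξ` at time `n`. The density of `ℙ^ξ` relative to `ℙ` is then the same on all their cylinders
(`IsBoundary.ae_condLaw_cylinder`): given `q`, the choices are independent with odds `μ(a) : μ(e)`,
and no trajectory has relative mass above `θ ^ k`, where `θ = choiceBound μ a 1 < 1`. Endpoints are
distinct, so Gibbs' inequality gives `q` at least `k * (-log θ)` times its probability in the
entropy of `w_n`, even if trajectories outside `q` share these endpoints. Summing over disjoint
collections and integrating over `Ξ_n` gives a linear lower bound. -/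

lemma iterate_shift_apply {α : Type*} (g : ℕ → α) (n k : ℕ) : shift^[n] g k = g (n + k) := by
  induction n generalizing g with
  | zero => simp
  | succ n ih => rw [Function.iterate_succ_apply, ih, shift]; congr 1; omega

/-! ### Product measures on sequences: splitting off initial letters. -/

section Product

variable {α : Type*} [MeasurableSpace α]

/-- Prepend a letter to a sequence. -/
def cons (p : α × (ℕ → α)) : ℕ → α
  | 0 => p.1
  | n + 1 => p.2 n

lemma measurable_cons : Measurable (cons : α × (ℕ → α) → ℕ → α) := by
  refine measurable_pi_lambda _ fun n => ?_
  cases n with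
  | zero => exact measurable_fst
  | succ n => exact (measurable_pi_apply n).comp measurable_snd

lemma measurable_shift : Measurable (shift : (ℕ → α) → ℕ → α) :=
  measurable_pi_lambda _ fun n => measurable_pi_apply (n + 1)

lemma infinitePi_eq_map_cons (μ : Measure α) [IsProbabilityMeasure μ] :
    (μ.prod (Measure.infinitePi fun _ : ℕ => μ)).map cons = Measure.infinitePi fun _ : ℕ => μ := by
  classical
  refine Measure.eq_infinitePi _ fun s t ht => ?_
  obtain ⟨N, hN⟩ : ∃ N, s ⊆ Finset.range (N + 1) :=
    ⟨s.sup id, fun i hi => Finset.mem_range.2 (Nat.lt_succ_of_le (Finset.le_sup (f := id) hi))⟩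
  -- Enlarging the index set to an initial segment, with trivial constraints off `s`, lets
  -- coordinate 0 split off uniformly.
  set t' : ℕ → Set α := fun i => if i ∈ s then t i else Set.univ with ht'
  have hm : ∀ i, MeasurableSet (t' i) := fun i => by
    simp only [ht']; split_ifs
    exacts [ht i, MeasurableSet.univ]
  have h1 : (s : Set ℕ).pi t = (Finset.range (N + 1) : Set ℕ).pi t' := by
    ext g
    simp only [Set.mem_pi, ht']
    refine ⟨fun h i _ => ?_, fun h i hi => ?_⟩
    · split_ifs with his
      exacts [h i his, Set.mem_univ _]
    · have := h i (hN hi)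
      rwa [if_pos (Finset.mem_coe.1 hi)] at this
  have h2 : ∏ i ∈ s, μ (t i) = ∏ i ∈ Finset.range (N + 1), μ (t' i) := by
    rw [← Finset.prod_subset hN (f := fun i => μ (t' i))]
    · exact Finset.prod_congr rfl fun i hi => by simp [ht', hi]
    · intro i _ hi
      simp [ht', hi]
  have h3 : cons ⁻¹' ((Finset.range (N + 1) : Set ℕ).pi t')
      = t' 0 ×ˢ (Finset.range N : Set ℕ).pi fun i => t' (i + 1) := by
    ext ⟨x, g⟩
    simp only [Set.mem_preimage, Set.mem_pi, Set.mem_prod, Finset.coe_range, Set.mem_Iio]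
    refine ⟨fun h => ⟨h 0 (by omega), fun i hi => h (i + 1) (by omega)⟩, fun h i hi => ?_⟩
    cases i with
    | zero => exact h.1
    | succ i => exact h.2 i (by omega)
  rw [h1, h2, Measure.map_apply measurable_cons
    (MeasurableSet.pi (Set.to_countable _) fun i _ => hm i), h3, Measure.prod_prod,
    Measure.infinitePi_pi _ fun i _ => hm (i + 1), Finset.prod_range_succ', mul_comm]

lemma infinitePi_eq_tsum_cons [Countable α] [MeasurableSingletonClass α]
    (μ : Measure α) [IsProbabilityMeasure μ] {S : Set (ℕ → α)} (hS : MeasurableSet S) :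
    Measure.infinitePi (fun _ : ℕ => μ) S
      = ∑' x, μ {x} * Measure.infinitePi (fun _ : ℕ => μ) {g | cons (x, g) ∈ S} := by
  conv_lhs => rw [← infinitePi_eq_map_cons μ, Measure.map_apply measurable_cons hS,
    Measure.prod_apply (measurable_cons hS), lintegral_countable']
  exact tsum_congr fun x => mul_comm _ _

/-- An event that depends on the first `n` coordinates is independent of the later ones. -/
lemma infinitePi_inter_iterate_shift [Countable α] [MeasurableSingletonClass α]
    (μ : Measure α) [IsProbabilityMeasure μ] (n : ℕ) {E F : Set (ℕ → α)} (hE : MeasurableSet E)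
    (hEn : ∀ g g' : ℕ → α, (∀ j < n, g j = g' j) → g ∈ E → g' ∈ E) (hF : MeasurableSet F) :
    Measure.infinitePi (fun _ : ℕ => μ) (E ∩ shift^[n] ⁻¹' F)
      = Measure.infinitePi (fun _ : ℕ => μ) E * Measure.infinitePi (fun _ : ℕ => μ) F := by
  induction n generalizing E with
  | zero =>
    -- An event depending on no coordinates is empty or everything.
    rcases E.eq_empty_or_nonempty with rfl | ⟨g, hg⟩
    · simp
    · have : E = Set.univ := Set.eq_univ_of_forall fun g' => hEn g g' (by simp) hg
      simp [this]
  | succ n ih =>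
    have hc : ∀ x : α, Measurable fun g : ℕ → α => cons (x, g) := fun x =>
      measurable_cons.comp measurable_prodMk_left
    rw [infinitePi_eq_tsum_cons μ (hE.inter ((measurable_shift.iterate (n + 1)) hF)),
      infinitePi_eq_tsum_cons μ hE, ← ENNReal.tsum_mul_right]
    refine tsum_congr fun x => ?_
    rw [mul_assoc, ← ih (E := {g | cons (x, g) ∈ E}) (hc x hE)]
    · rfl
    · intro g g' hgg' hg
      refine hEn _ _ (fun j hj => ?_) hg
      cases j with
      | zero => rfl
      | succ j => exact hgg' j (by omega)

end Product

/-! ### The random walk, its Markov property and the boundary map. -/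

section Walk

variable {G : Type*} [Group G]

lemma path_add (g : ℕ → G) (n k : ℕ) : path g (n + k) = path g n * path (shift^[n] g) k := by
  induction k with
  | zero => simp [path]
  | succ k ih => rw [← add_assoc, path, ih, path, iterate_shift_apply, mul_assoc]

lemma path_congr {g g' : ℕ → G} {n : ℕ} (h : ∀ j < n, g j = g' j) : path g n = path g' n := by
  induction n with
  | zero => rfl
  | succ n ih => rw [path, path, ih fun j hj => h j (by omega), h n (by omega)]

/-- The walk after time `n`, translated back to the identity. -/
def restart (n : ℕ) (w : ℕ → G) : ℕ → G := fun k => (w n)⁻¹ * w (n + k)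

lemma restart_path (n : ℕ) (g : ℕ → G) : restart n (path g) = path (shift^[n] g) := by
  funext k
  simp [restart, path_add]

variable [Countable G] [MeasurableSpace G] [DiscreteMeasurableSpace G]

lemma measurable_path : Measurable (path : (ℕ → G) → ℕ → G) := by
  refine measurable_pi_lambda _ fun n => ?_
  induction n with
  | zero => exact measurable_const
  | succ n ih => exact ih.mul (measurable_pi_apply n)

variable (μ : Measure G) [IsProbabilityMeasure μ]

instance isProbabilityMeasure_law : IsProbabilityMeasure (law μ) :=
  Measure.isProbabilityMeasure_map measurable_path.aemeasurable

lemma measurable_restart (n : ℕ) : Measurable (restart n : (ℕ → G) → ℕ → G) :=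
  measurable_pi_lambda _ fun k =>
    (measurable_pi_apply n).inv.mul (measurable_pi_apply (n + k))

/-- The Markov property. -/
lemma law_inter_restart (n : ℕ) {E F : Set (ℕ → G)} (hE : MeasurableSet E)
    (hEn : ∀ w w' : ℕ → G, (∀ j ≤ n, w j = w' j) → w ∈ E → w' ∈ E) (hF : MeasurableSet F) :
    law μ (E ∩ restart n ⁻¹' F) = law μ E * law μ F := by
  rw [law, Measure.map_apply measurable_path (hE.inter (measurable_restart n hF)),
    Measure.map_apply measurable_path hE, Measure.map_apply measurable_path hF,
    ← infinitePi_inter_iterate_shift μ n (measurable_path hE) _ (measurable_path hF)]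
  · congr 1
    ext g
    simp [restart_path]
  · exact fun g g' h => hEn _ _ fun j hj => path_congr fun i hi => h i (by omega)

lemma measurePreserving_restart (n : ℕ) : MeasurePreserving (restart n) (law μ) (law μ) := by
  refine ⟨measurable_restart n, Measure.ext fun F hF => ?_⟩
  rw [Measure.map_apply (measurable_restart n) hF]
  simpa using law_inter_restart μ n (E := Set.univ) MeasurableSet.univ (by simp) hF

lemma ae_zero_eq_one : ∀ᵐ w ∂law μ, w 0 = 1 := by
  refine (ae_map_iff measurable_path.aemeasurable ?_).2 (ae_of_all _ fun g => rfl)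
  exact measurable_pi_apply 0 (measurableSet_singleton 1)

/-- The probability that the increments of the walk up to time `n` are `s 0, …, s (n - 1)`. -/
lemma law_path_eq (n : ℕ) (s : ℕ → G) :
    law μ {w | ∀ j < n, w (j + 1) = path s (j + 1)} = ∏ j ∈ Finset.range n, μ {s j} := by
  have hm : MeasurableSet {w : ℕ → G | ∀ j < n, w (j + 1) = path s (j + 1)} := by
    simp only [Set.ofPred_forall]
    exact MeasurableSet.iInter fun j => MeasurableSet.iInter fun _ =>
      measurable_pi_apply (j + 1) (measurableSet_singleton _)
  rw [law, Measure.map_apply measurable_path hm,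
    ← Measure.infinitePi_pi (μ := fun _ => μ) fun i _ => measurableSet_singleton (s i)]
  congr 1
  ext g
  simp only [Set.mem_preimage, Set.mem_ofPred_eq, Set.mem_pi, Finset.coe_range, Set.mem_Iio,
    Set.mem_singleton_iff]
  refine ⟨fun h j hj => ?_, fun h j hj => path_congr fun i hi => h i (by omega)⟩
  have h1 : path g j = path s j := by
    cases j with
    | zero => rfl
    | succ j => exact h j (by omega)
  have := h j hj
  rwa [path, path, h1, mul_right_inj] at this

variable {μ} {X : Type*} [MeasurableSpace X] [MulAction G X] {ν : Measure X} {bnd : (ℕ → G) → X}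

/-- The shifted walk is `w 1` times the restarted one. As `G` is countable, equivariance holds
almost surely for all group elements at once, hence for the random element `w 1`. -/
lemma IsBoundary.ae_eq_smul_restart_one (hX : IsBoundary μ ν bnd) :
    ∀ᵐ w ∂law μ, bnd w = w 1 • bnd (restart 1 w) := by
  have h := (measurePreserving_restart μ 1).quasiMeasurePreserving.ae (ae_all_iff.2 hX.equivariant)
  filter_upwards [h, hX.shift_invariant 1] with w h1 h2
  simp only [one_mul] at h2
  rw [← h2, ← h1]
  congr 1
  funext k
  simp [restart, shift, add_comm]

lemma IsBoundary.ae_eq_smul_restart (hX : IsBoundary μ ν bnd) (n : ℕ) :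
    ∀ᵐ w ∂law μ, bnd w = w n • bnd (restart n w) := by
  induction n with
  | zero =>
    filter_upwards [ae_zero_eq_one μ] with w h
    have : restart 0 w = w := by funext k; simp [restart, h]
    rw [this, h, one_smul]
  | succ n ih =>
    filter_upwards [ih, (measurePreserving_restart μ n).quasiMeasurePreserving.ae
      hX.ae_eq_smul_restart_one] with w h1 h2
    rw [h1, h2, ← mul_smul]
    congr 2
    · simp [restart]
    · funext k
      simp [restart, add_assoc, mul_assoc]

/-- The Markov property, jointly with the boundary point. -/
lemma IsBoundary.law_inter_restart_inter (hX : IsBoundary μ ν bnd) [MeasurableConstSMul G X]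
    (n : ℕ) (h : G) {E F : Set (ℕ → G)} {B : Set X} (hE : MeasurableSet E)
    (hEn : ∀ w w' : ℕ → G, (∀ j ≤ n, w j = w' j) → w ∈ E → w' ∈ E) (hEh : ∀ w ∈ E, w n = h)
    (hF : MeasurableSet F) (hB : MeasurableSet B) :
    law μ ((E ∩ restart n ⁻¹' F) ∩ bnd ⁻¹' B)
      = law μ E * law μ (F ∩ bnd ⁻¹' ((h • ·) ⁻¹' B)) := by
  rw [← law_inter_restart μ n hE hEn (hF.inter (hX.measurable (measurable_const_smul h hB)))]
  refine measure_congr ?_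
  filter_upwards [hX.ae_eq_smul_restart n] with w hw
  refine propext ?_
  change (_ ∧ _) ∧ _ ↔ _ ∧ _ ∧ _
  rw [and_assoc]
  refine and_congr_right fun hwE => and_congr_right fun _ => ?_
  change bnd w ∈ B ↔ h • bnd (restart n w) ∈ B
  rw [hw, hEh w hwE]

/-- The joint law of an event up to time `n`, on which the walk arrives at `h`, and of the boundary
point. -/
lemma IsBoundary.law_inter (hX : IsBoundary μ ν bnd) [MeasurableConstSMul G X]
    (n : ℕ) (h : G) {E : Set (ℕ → G)} {B : Set X} (hE : MeasurableSet E)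
    (hEn : ∀ w w' : ℕ → G, (∀ j ≤ n, w j = w' j) → w ∈ E → w' ∈ E) (hEh : ∀ w ∈ E, w n = h)
    (hB : MeasurableSet B) :
    law μ (E ∩ bnd ⁻¹' B) = law μ E * ν ((h • ·) ⁻¹' B) := by
  have := hX.law_inter_restart_inter n h hE hEn hEh MeasurableSet.univ hB
  rwa [Set.preimage_univ, Set.inter_univ, Set.univ_inter,
    ← Measure.map_apply hX.measurable (measurable_const_smul h hB), hX.map_eq] at this

end Walk

/-! ### Entropy of atoms and information content. -/

section Entropy

open scoped ENNReal

/-- The contribution `-t log t` of an atom of mass `t` to the entropy. -/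
noncomputable def entropyTerm (t : ℝ≥0∞) : ℝ≥0∞ := ENNReal.ofReal (Real.negMulLog t.toReal)

/-- The information content `-log t` of an event of probability `t`. -/
noncomputable def info (t : ℝ≥0∞) : ℝ≥0∞ := ENNReal.ofReal (-Real.log t.toReal)

lemma measurable_entropyTerm : Measurable entropyTerm :=
  (Real.continuous_negMulLog.measurable.comp ENNReal.measurable_toReal).ennreal_ofReal

lemma toReal_le_one {t : ℝ≥0∞} (ht : t ≤ 1) : t.toReal ≤ 1 :=
  ENNReal.toReal_le_of_le_ofReal zero_le_one (by simpa using ht)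

lemma entropyTerm_eq_mul_info {t : ℝ≥0∞} (ht : t ≤ 1) : entropyTerm t = t * info t := by
  have ht' : t ≠ ∞ := (ht.trans_lt ENNReal.one_lt_top).ne
  rw [entropyTerm, info, Real.negMulLog, neg_mul, ← mul_neg,
    ENNReal.ofReal_mul ENNReal.toReal_nonneg, ENNReal.ofReal_toReal ht']

/-- The case `s = 0` is excluded because `Real.log 0 = 0` makes `info 0` vanish. -/
lemma info_le_info {s t : ℝ≥0∞} (hs : s ≠ 0) (hst : s ≤ t) (ht : t ≤ 1) : info t ≤ info s := by
  have ht' : t ≠ ∞ := (ht.trans_lt ENNReal.one_lt_top).ne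
  have hs' : s ≠ ∞ := (hst.trans_lt ht'.lt_top).ne
  exact ENNReal.ofReal_le_ofReal (neg_le_neg (Real.log_le_log (ENNReal.toReal_pos hs hs')
    (ENNReal.toReal_mono ht' hst)))

/-- Refining a partition increases entropy: each piece carries at least the information of the
whole. -/
lemma entropyTerm_tsum_le {ι : Type*} {f : ι → ℝ≥0∞} (hf : ∑' i, f i ≤ 1) :
    entropyTerm (∑' i, f i) ≤ ∑' i, entropyTerm (f i) := by
  rw [entropyTerm_eq_mul_info hf, ← ENNReal.tsum_mul_right]
  refine ENNReal.tsum_le_tsum fun i => ?_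
  rw [entropyTerm_eq_mul_info ((ENNReal.le_tsum i).trans hf)]
  rcases eq_or_ne (f i) 0 with h | h
  · simp [h]
  · exact mul_le_mul_right (info_le_info h (ENNReal.le_tsum i) hf) _

lemma entropyTerm_mul {s t : ℝ≥0∞} (hs : s ≤ 1) (ht : t ≤ 1) :
    entropyTerm (s * t) = s * entropyTerm t + t * entropyTerm s := by
  have hs' : s ≠ ∞ := (hs.trans_lt ENNReal.one_lt_top).ne
  have ht' : t ≠ ∞ := (ht.trans_lt ENNReal.one_lt_top).ne
  have h1 := Real.negMulLog_nonneg ENNReal.toReal_nonneg (toReal_le_one hs)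
  have h2 := Real.negMulLog_nonneg ENNReal.toReal_nonneg (toReal_le_one ht)
  rw [entropyTerm, ENNReal.toReal_mul, Real.negMulLog_mul,
    ENNReal.ofReal_add (mul_nonneg ENNReal.toReal_nonneg h1)
      (mul_nonneg ENNReal.toReal_nonneg h2), ENNReal.ofReal_mul ENNReal.toReal_nonneg,
    ENNReal.ofReal_mul ENNReal.toReal_nonneg, ENNReal.ofReal_toReal hs', ENNReal.ofReal_toReal ht',
    add_comm]
  rfl

/-- Jensen's inequality for the entropy function. -/
lemma lintegral_entropyTerm_le {X : Type*} [MeasurableSpace X] {ν : Measure X}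
    [IsProbabilityMeasure ν] {f : X → ℝ≥0∞} (hf : Measurable f) (hf1 : ∀ x, f x ≤ 1) :
    ∫⁻ x, entropyTerm (f x) ∂ν ≤ entropyTerm (∫⁻ x, f x ∂ν) := by
  have h0 : ∀ x, 0 ≤ Real.negMulLog (f x).toReal := fun x =>
    Real.negMulLog_nonneg ENNReal.toReal_nonneg (toReal_le_one (hf1 x))
  have i1 : Integrable (fun x => (f x).toReal) ν :=
    Integrable.of_bound hf.ennreal_toReal.aestronglyMeasurable 1 (ae_of_all _ fun x => by
      rw [Real.norm_of_nonneg ENNReal.toReal_nonneg]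
      exact toReal_le_one (hf1 x))
  have i2 : Integrable (fun x => Real.negMulLog (f x).toReal) ν := by
    refine Integrable.of_bound
      (Real.continuous_negMulLog.measurable.comp hf.ennreal_toReal).aestronglyMeasurable 1
      (ae_of_all _ fun x => ?_)
    rw [Real.norm_of_nonneg (h0 x)]
    have h1 : 0 ≤ (f x).toReal := ENNReal.toReal_nonneg
    linarith [Real.negMulLog_le_one_sub_self h1]
  have h := Real.concaveOn_negMulLog.le_map_integral Real.continuous_negMulLog.continuousOn
    isClosed_Ici (ae_of_all ν fun x => ENNReal.toReal_nonneg (a := f x)) i1 i2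
  simp only [entropyTerm]
  rw [← ofReal_integral_eq_lintegral_ofReal i2 (ae_of_all _ h0),
    ← integral_toReal hf.aemeasurable (ae_of_all _ fun x => (hf1 x).trans_lt ENNReal.one_lt_top)]
  exact ENNReal.ofReal_le_ofReal h

end Entropy

lemma measurableSet_position {G : Type*} [Countable G] [MeasurableSpace G]
    [DiscreteMeasurableSpace G] (n : ℕ) (g : G) : MeasurableSet {w : ℕ → G | w n = g} :=
  (measurable_pi_apply n : Measurable fun w : ℕ → G => w n) (measurableSet_singleton g)

lemma tsum_measure_position {G : Type*} [Countable G] [MeasurableSpace G]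
    [DiscreteMeasurableSpace G] (m : Measure (ℕ → G)) [IsProbabilityMeasure m] (n : ℕ) :
    ∑' g, m {w | w n = g} = 1 := by
  rw [← measure_iUnion (fun g g' hgg' => Set.disjoint_left.2 fun w h h' => hgg' (h.symm.trans h'))
    (fun g => measurableSet_position n g)]
  rw [← measure_univ (μ := m)]
  congr 1
  ext w
  simp

/-! ### The walk conditioned on its boundary point; subadditivity of entropy. -/

section ConditionalWalk

variable {G : Type*} [Group G] [Countable G] [MeasurableSpace G] [DiscreteMeasurableSpace G]
  {μ : Measure G} [IsProbabilityMeasure μ] {X : Type*} [MeasurableSpace X]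
  {ν : Measure X} {bnd : (ℕ → G) → X}

instance isMarkovKernel_condLaw : IsMarkovKernel (condLaw μ bnd) := by
  rw [condLaw]; infer_instance

lemma condEntropy_eq (n : ℕ) (ξ : X) :
    condEntropy μ bnd n ξ = ∑' g, entropyTerm (condLaw μ bnd ξ {w | w n = g}) := rfl

lemma measurable_condEntropy (n : ℕ) : Measurable (condEntropy μ bnd n) := by
  refine Measurable.tsum fun g => measurable_entropyTerm.comp ?_
  exact Kernel.measurable_coe _ (measurableSet_position n g)

variable [MulAction G X]

lemma IsBoundary.isProbabilityMeasure (hX : IsBoundary μ ν bnd) : IsProbabilityMeasure ν := by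
  rw [← hX.map_eq]
  exact Measure.isProbabilityMeasure_map hX.measurable.aemeasurable

/-- Apart from being a Markov kernel, this is the only property of `condLaw` that is used. -/
lemma IsBoundary.setLIntegral_condLaw (hX : IsBoundary μ ν bnd) {B : Set X} (hB : MeasurableSet B)
    {E : Set (ℕ → G)} (hE : MeasurableSet E) :
    ∫⁻ ξ in B, condLaw μ bnd ξ E ∂ν = law μ (E ∩ bnd ⁻¹' B) := by
  have h := compProd_map_condDistrib (μ := law μ) (X := bnd) (Y := id) (mβ := inferInstance)
    measurable_id.aemeasurable
  have h' := congrArg (fun m => m (B ×ˢ E)) h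
  change (_ ⊗ₘ _) _ = _ at h'
  rw [hX.map_eq, Measure.map_apply (hX.measurable.prodMk measurable_id) (hB.prod hE)] at h'
  have := hX.isProbabilityMeasure
  rw [Measure.compProd_apply_prod hB hE] at h'
  rw [condLaw, h', Set.inter_comm]
  rfl

lemma law_position_one (g : G) : law μ {w | w 1 = g} = μ {g} := by
  rw [law, Measure.map_apply measurable_path (measurableSet_position 1 g)]
  rw [← (measurePreserving_eval_infinitePi (fun _ : ℕ => μ) 0).measure_preimage
    (measurableSet_singleton g).nullMeasurableSet]
  congr 1
  ext w
  simp [path]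

/-- Conditioning decreases entropy: Jensen is applied to each atom, whose mean conditional mass is
`μ {g}`. -/
lemma IsBoundary.meanCondEntropy_one_le (hX : IsBoundary μ ν bnd) :
    meanCondEntropy μ ν bnd 1 ≤ shannonEntropy μ := by
  have := hX.isProbabilityMeasure
  have hm : ∀ g : G, Measurable fun ξ => condLaw μ bnd ξ {w | w 1 = g} := fun g =>
    Kernel.measurable_coe _ (measurableSet_position 1 g)
  simp only [meanCondEntropy, condEntropy_eq]
  have hm' : ∀ g : G, Measurable fun ξ => entropyTerm (condLaw μ bnd ξ {w | w 1 = g}) := fun g =>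
    measurable_entropyTerm.comp (hm g)
  rw [lintegral_tsum fun g => (hm' g).aemeasurable]
  refine ENNReal.tsum_le_tsum fun g => ?_
  refine (lintegral_entropyTerm_le (hm g) fun ξ => prob_le_one).trans (le_of_eq ?_)
  have := hX.setLIntegral_condLaw MeasurableSet.univ (measurableSet_position (G := G) 1 g)
  rw [setLIntegral_univ, Set.preimage_univ, Set.inter_univ, law_position_one] at this
  rw [this]
  rfl

variable [MeasurableConstSMul G X]

/-- The measure with density `ξ ↦ ℙ^ξ(E)` is `ℙ(E)` times the image of `ν` under `h`: a Doob
transform stated without a Radon–Nikodym derivative of that image. -/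
lemma IsBoundary.setLIntegral_condLaw_mul (hX : IsBoundary μ ν bnd) (n : ℕ) (h : G)
    {E : Set (ℕ → G)} {B : Set X} (hE : MeasurableSet E)
    (hEn : ∀ w w' : ℕ → G, (∀ j ≤ n, w j = w' j) → w ∈ E → w' ∈ E) (hEh : ∀ w ∈ E, w n = h)
    (hB : MeasurableSet B) {f : X → ENNReal} (hf : Measurable f) :
    ∫⁻ ξ in B, condLaw μ bnd ξ E * f (h⁻¹ • ξ) ∂ν
      = law μ E * ∫⁻ x in (h • ·) ⁻¹' B, f x ∂ν := by
  have hd : ν.withDensity (fun ξ => condLaw μ bnd ξ E) = law μ E • ν.map (h • ·) := by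
    refine Measure.ext fun C hC => ?_
    rw [withDensity_apply _ hC, hX.setLIntegral_condLaw hC hE, hX.law_inter n h hE hEn hEh hC,
      Measure.smul_apply, Measure.map_apply (measurable_const_smul h) hC, smul_eq_mul]
  have hf' : Measurable fun ξ : X => f (h⁻¹ • ξ) := hf.comp (measurable_const_smul _)
  have h1 := setLIntegral_withDensity_eq_setLIntegral_mul ν
    (Kernel.measurable_coe (condLaw μ bnd) hE) hf' hB
  simp only [Pi.mul_apply] at h1
  rw [← h1, hd, Measure.restrict_smul, lintegral_smul_measure,
    setLIntegral_map hB hf' (measurable_const_smul h)]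
  simp

/-- Integrated over any `B`, both sides give the probability that the walk is at `g` at time `n + m`
with boundary point in `B`, the right one split by the position at time `n`. -/
lemma IsBoundary.ae_condLaw_add (hX : IsBoundary μ ν bnd) (n m : ℕ) :
    ∀ᵐ ξ ∂ν, ∀ g, condLaw μ bnd ξ {w | w (n + m) = g}
      = ∑' h, condLaw μ bnd ξ {w | w n = h} * condLaw μ bnd (h⁻¹ • ξ) {w | w m = h⁻¹ * g} := by
  have := hX.isProbabilityMeasure
  refine ae_all_iff.2 fun g => ?_
  have hm : ∀ k (g : G), Measurable fun ξ => condLaw μ bnd ξ {w | w k = g} := fun k g =>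
    Kernel.measurable_coe _ (measurableSet_position k g)
  have hm' : ∀ h : G, Measurable fun ξ : X =>
      condLaw μ bnd ξ {w | w n = h} * condLaw μ bnd (h⁻¹ • ξ) {w | w m = h⁻¹ * g} := fun h =>
    (hm n h).mul ((hm m _).comp (measurable_const_smul h⁻¹))
  refine ae_eq_of_forall_setLIntegral_eq_of_sigmaFinite (hm _ _) (Measurable.tsum hm')
    fun B hB _ => ?_
  have hE : ∀ h : G, ∀ w w' : ℕ → G, (∀ j ≤ n, w j = w' j) →
      w ∈ {w : ℕ → G | w n = h} → w' ∈ {w : ℕ → G | w n = h} := fun h w w' hww' hw =>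
    (hww' n le_rfl).symm.trans hw
  rw [hX.setLIntegral_condLaw hB (measurableSet_position _ _),
    lintegral_tsum fun h => (hm' h).aemeasurable]
  have key : ∀ h : G, ∫⁻ ξ in B, condLaw μ bnd ξ {w | w n = h}
      * condLaw μ bnd (h⁻¹ • ξ) {w | w m = h⁻¹ * g} ∂ν
      = law μ (({w | w n = h} ∩ restart n ⁻¹' {w | w m = h⁻¹ * g}) ∩ bnd ⁻¹' B) := fun h => by
    rw [hX.setLIntegral_condLaw_mul n h (measurableSet_position n h) (hE h) (fun w hw => hw) hB
      (hm m _), hX.setLIntegral_condLaw (measurable_const_smul h hB) (measurableSet_position _ _),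
      hX.law_inter_restart_inter n h (measurableSet_position n h) (hE h) (fun w hw => hw)
        (measurableSet_position _ _) hB]
  simp only [key]
  rw [← measure_iUnion]
  · congr 1
    ext w
    simp [restart]
  · exact fun h h' hhh' => Set.disjoint_left.2 fun w hw hw' =>
      hhh' (hw.1.1.symm.trans hw'.1.1)
  · exact fun h => ((measurableSet_position n h).inter
      (measurable_restart n (measurableSet_position _ _))).inter (hX.measurable hB)

/-- The position at time `n + m` has at most the joint entropy with the position at time `n`, which
the chain rule evaluates. -/
lemma IsBoundary.ae_condEntropy_add_le (hX : IsBoundary μ ν bnd) (n m : ℕ) :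
    ∀ᵐ ξ ∂ν, condEntropy μ bnd (n + m) ξ ≤ condEntropy μ bnd n ξ
      + ∑' h, condLaw μ bnd ξ {w | w n = h} * condEntropy μ bnd m (h⁻¹ • ξ) := by
  filter_upwards [hX.ae_condLaw_add n m] with ξ hξ
  calc condEntropy μ bnd (n + m) ξ
      ≤ ∑' g, ∑' h, entropyTerm (condLaw μ bnd ξ {w | w n = h}
          * condLaw μ bnd (h⁻¹ • ξ) {w | w m = h⁻¹ * g}) := by
        rw [condEntropy_eq]
        refine ENNReal.tsum_le_tsum fun g => ?_
        have h1 : condLaw μ bnd ξ {w | w (n + m) = g} ≤ 1 := prob_le_one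
        rw [hξ g] at h1 ⊢
        exact entropyTerm_tsum_le h1
    _ = ∑' h, ∑' g, (condLaw μ bnd ξ {w | w n = h}
          * entropyTerm (condLaw μ bnd (h⁻¹ • ξ) {w | w m = h⁻¹ * g})
          + condLaw μ bnd (h⁻¹ • ξ) {w | w m = h⁻¹ * g}
          * entropyTerm (condLaw μ bnd ξ {w | w n = h})) := by
        rw [ENNReal.tsum_comm]
        exact tsum_congr fun h => tsum_congr fun g => entropyTerm_mul prob_le_one prob_le_one
    _ = _ := by
        rw [condEntropy_eq, ← ENNReal.tsum_add]
        refine tsum_congr fun h => ?_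
        have h1 := (Equiv.mulLeft h⁻¹).tsum_eq fun g => condLaw μ bnd (h⁻¹ • ξ) {w | w m = g}
        have h2 := (Equiv.mulLeft h⁻¹).tsum_eq fun g =>
          entropyTerm (condLaw μ bnd (h⁻¹ • ξ) {w | w m = g})
        simp only [Equiv.coe_mulLeft] at h1 h2
        rw [ENNReal.tsum_add, ENNReal.tsum_mul_left, ENNReal.tsum_mul_right, condEntropy_eq, h1, h2,
          tsum_measure_position, one_mul, add_comm]

lemma IsBoundary.meanCondEntropy_add_le (hX : IsBoundary μ ν bnd) (n m : ℕ) :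
    meanCondEntropy μ ν bnd (n + m) ≤ meanCondEntropy μ ν bnd n + meanCondEntropy μ ν bnd m := by
  have hm : ∀ h : G, Measurable fun ξ : X =>
      condLaw μ bnd ξ {w | w n = h} * condEntropy μ bnd m (h⁻¹ • ξ) := fun h =>
    (Kernel.measurable_coe _ (measurableSet_position n h)).mul
      ((measurable_condEntropy m).comp (measurable_const_smul h⁻¹))
  refine (lintegral_mono_ae (hX.ae_condEntropy_add_le n m)).trans (le_of_eq ?_)
  rw [lintegral_add_left (measurable_condEntropy n),
    lintegral_tsum fun h => (hm h).aemeasurable]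
  congr 1
  have key : ∀ h : G, ∫⁻ ξ, condLaw μ bnd ξ {w | w n = h} * condEntropy μ bnd m (h⁻¹ • ξ) ∂ν
      = law μ {w | w n = h} * meanCondEntropy μ ν bnd m := fun h => by
    have := hX.setLIntegral_condLaw_mul n h (measurableSet_position n h)
      (fun w w' hww' hw => (hww' n le_rfl).symm.trans hw) (fun w hw => hw) MeasurableSet.univ
      (measurable_condEntropy (μ := μ) (bnd := bnd) m)
    rwa [Set.preimage_univ, setLIntegral_univ, setLIntegral_univ] at this
  simp only [key]
  rw [ENNReal.tsum_mul_right, tsum_measure_position, one_mul]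

lemma IsBoundary.meanCondEntropy_le (hX : IsBoundary μ ν bnd) (n : ℕ) :
    meanCondEntropy μ ν bnd (n + 1) ≤ (n + 1 : ℕ) * shannonEntropy μ := by
  induction n with
  | zero => simpa using hX.meanCondEntropy_one_le
  | succ n ih =>
    refine (hX.meanCondEntropy_add_le (n + 1) 1).trans ?_
    rw [Nat.cast_succ, add_mul, one_mul]
    exact add_le_add ih hX.meanCondEntropy_one_le

end ConditionalWalk

/-- Gibbs' inequality for a sub-probability vector `m` and a vector `P ≤ m` without atoms of
relative mass greater than `t`. -/
lemma sum_mul_neg_log_le {ι : Type*} (I : Finset ι) {P m : ι → ℝ} {t : ℝ} (ht : 0 < t)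
    (hm : ∑ i ∈ I, m i ≤ 1) (hP : ∀ i ∈ I, 0 ≤ P i) (hPm : ∀ i ∈ I, P i ≤ m i)
    (hPt : ∀ i ∈ I, P i ≤ t * ∑ j ∈ I, P j) :
    (∑ i ∈ I, P i) * -Real.log t ≤ ∑ i ∈ I, P i * -Real.log (m i) := by
  set M := ∑ j ∈ I, P j with hM
  have hM0 : 0 ≤ M := Finset.sum_nonneg hP
  -- This is `log x ≤ x - 1` at `x = M * m i / P i`, combined with `P i ≤ t * M`. On summation the
  -- error `M - M * ∑ m i` is nonnegative.
  have key : ∀ i ∈ I, P i * -Real.log t + P i - M * m i ≤ P i * -Real.log (m i) := by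
    intro i hi
    rcases (hP i hi).eq_or_lt with h | h
    · rw [← h]
      have := mul_nonneg hM0 ((hP i hi).trans (hPm i hi))
      linarith
    · have hmi : 0 < m i := h.trans_le (hPm i hi)
      have hMp : 0 < M := by
        by_contra h'
        have h0 : M = 0 := le_antisymm (not_lt.1 h') hM0
        have := hPt i hi
        rw [h0, mul_zero] at this
        linarith
      have h1 : Real.log (M * m i / P i) ≤ M * m i / P i - 1 :=
        Real.log_le_sub_one_of_pos (by positivity)
      have h2 : Real.log (M * m i / P i) = Real.log M + Real.log (m i) - Real.log (P i) := by
        rw [Real.log_div (by positivity) h.ne', Real.log_mul hMp.ne' hmi.ne']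
      have h3 : Real.log (P i) ≤ Real.log t + Real.log M := by
        rw [← Real.log_mul ht.ne' hMp.ne']
        exact Real.log_le_log h (hPt i hi)
      have h4 : P i * (M * m i / P i) = M * m i := by field_simp
      have h5 : P i * (Real.log (m i) - Real.log t) ≤ P i * (M * m i / P i - 1) :=
        mul_le_mul_of_nonneg_left (by linarith) h.le
      nlinarith
  have h := Finset.sum_le_sum key
  rw [Finset.sum_sub_distrib, Finset.sum_add_distrib, ← Finset.sum_mul, ← Finset.mul_sum,
    ← hM] at h
  nlinarith

/-- Cylinders do not constrain time 0, so agreement there is a separate hypothesis. -/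
lemma eq_of_mem_cylinder {G : Type*} {n : ℕ} {y y' : Fin (n + 1) → G} (h : y 0 = y' 0) {w : ℕ → G}
    (hw : w ∈ cylinder y) (hw' : w ∈ cylinder y') : y = y' := by
  funext i
  refine Fin.cases h (fun j => ?_) i
  exact (hw j).symm.trans (hw' j)

lemma apply_eq_of_mem_cylinder {G : Type*} {n : ℕ} (hn : 0 < n) {y : Fin (n + 1) → G} {w : ℕ → G}
    (hw : w ∈ cylinder y) : w n = y (Fin.last n) := by
  obtain ⟨m, rfl⟩ := Nat.exists_eq_succ_of_ne_zero hn.ne'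
  exact hw (Fin.last m)

lemma measurableSet_cylinder {G : Type*} {n : ℕ} [MeasurableSpace G] [DiscreteMeasurableSpace G] [Countable G]
    (y : Fin (n + 1) → G) : MeasurableSet (cylinder y) := by
  have : cylinder y = ⋂ j : Fin n, {w | w (j + 1) = y j.succ} := by
    ext w; simp [cylinder]
  rw [this]
  exact MeasurableSet.iInter fun j => measurableSet_position _ _

/-! ### Probabilities of trajectories, with and without conditioning. -/

section Trajectory

variable {G : Type*} [Group G] {n : ℕ}

/-- The probability of the first `n` steps of a trajectory `y`. -/
noncomputable def weight [MeasurableSpace G] (μ : Measure G) (y : Fin (n + 1) → G) : ℝ :=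
  ∏ j : Fin n, μ.real {(y j.castSucc)⁻¹ * y j.succ}

variable [MeasurableSpace G] [DiscreteMeasurableSpace G] [Countable G]
  {μ : Measure G} [IsProbabilityMeasure μ]

lemma law_cylinder {y : Fin (n + 1) → G} (h0 : y 0 = 1) :
    law μ (cylinder y) = ENNReal.ofReal (weight μ y) := by
  -- The increments of `y`, padded by an irrelevant value from index `n` on.
  set s : ℕ → G := fun j => if h : j < n then
    (y (Fin.castSucc ⟨j, h⟩))⁻¹ * y (Fin.succ ⟨j, h⟩) else 1 with hs
  have hp : ∀ i (h : i < n + 1), path s i = y ⟨i, h⟩ := by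
    intro i
    induction i with
    | zero => exact fun h => h0.symm
    | succ i ih =>
      intro h
      rw [path, ih (by omega), hs]
      simp only [dif_pos (show i < n by omega)]
      simp
  have h1 := law_path_eq μ n s
  have h2 : {w : ℕ → G | ∀ j < n, w (j + 1) = path s (j + 1)} = cylinder y := by
    ext w
    refine ⟨fun h j => (h j j.2).trans (hp _ (by omega)), fun h j hj => ?_⟩
    exact (h ⟨j, hj⟩).trans (hp _ (by omega)).symm
  rw [← h2, h1, Finset.prod_range, weight, ENNReal.ofReal_prod_of_nonneg fun _ _ => measureReal_nonneg]
  refine Finset.prod_congr rfl fun j _ => ?_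
  rw [ofReal_measureReal, hs]
  simp only [dif_pos j.2]

/-- Conditionally on the boundary point `ξ`, trajectories to points `y`, `y'` with
`y⁻¹ ξ = y'⁻¹ ξ` have probabilities proportional to the unconditional ones. -/
lemma IsBoundary.ae_condLaw_cylinder {X : Type*} [MeasurableSpace X] [StandardBorelSpace X]
    [MulAction G X] [MeasurableConstSMul G X] {ν : Measure X} {bnd : (ℕ → G) → X}
    (hX : IsBoundary μ ν bnd) (hn : 0 < n) :
    ∀ᵐ ξ ∂ν, ∀ y y' : Fin (n + 1) → G, y 0 = 1 → y' 0 = 1 →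
      (y (Fin.last n))⁻¹ • ξ = (y' (Fin.last n))⁻¹ • ξ →
      (condLaw μ bnd ξ).real (cylinder y) * weight μ y'
        = (condLaw μ bnd ξ).real (cylinder y') * weight μ y := by
  have := hX.isProbabilityMeasure
  refine ae_all_iff.2 fun y => ae_all_iff.2 fun y' => ?_
  by_cases h0 : y 0 = 1
  swap
  · exact ae_of_all _ fun ξ h => absurd h h0
  by_cases h0' : y' 0 = 1
  swap
  · exact ae_of_all _ fun ξ _ h => absurd h h0'
  set D : Set X := {ξ | (y (Fin.last n))⁻¹ • ξ = (y' (Fin.last n))⁻¹ • ξ} with hD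
  have hDm : MeasurableSet D :=
    measurableSet_eq_fun (measurable_const_smul _) (measurable_const_smul _)
  have hm : ∀ y : Fin (n + 1) → G, Measurable fun ξ => condLaw μ bnd ξ (cylinder y) := fun y =>
    Kernel.measurable_coe _ (measurableSet_cylinder y)
  have hE : ∀ (y : Fin (n + 1) → G), y 0 = 1 → ∀ B : Set X, MeasurableSet B →
      ∫⁻ ξ in B, condLaw μ bnd ξ (cylinder y) ∂ν
        = ENNReal.ofReal (weight μ y) * ν ((y (Fin.last n) • ·) ⁻¹' B) := by
    intro y hy B hB
    rw [hX.setLIntegral_condLaw hB (measurableSet_cylinder y),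
      hX.law_inter n (y (Fin.last n)) (measurableSet_cylinder y) _
        (fun w hw => apply_eq_of_mem_cylinder hn hw) hB, law_cylinder hy]
    exact fun w w' hww' hw j => (hww' _ (by omega)).symm.trans (hw j)
  -- If one of the two endpoints moves `x` into `D`, then both move `x` to the same point.
  have hset : ∀ B ⊆ D, (y (Fin.last n) • · : X → X) ⁻¹' B = (y' (Fin.last n) • ·) ⁻¹' B := by
    intro B hB
    ext x
    simp only [Set.mem_preimage]
    constructor
    · intro hx
      have := hB hx
      simp only [hD, Set.mem_ofPred_eq, inv_smul_smul] at this
      rw [eq_inv_smul_iff] at this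
      rwa [this]
    · intro hx
      have := hB hx
      simp only [hD, Set.mem_ofPred_eq, inv_smul_smul] at this
      rw [eq_comm, eq_inv_smul_iff] at this
      rwa [this]
  -- Cross-multiplication avoids dividing by weights, which may vanish.
  have key : (fun ξ => condLaw μ bnd ξ (cylinder y) * ENNReal.ofReal (weight μ y'))
      =ᵐ[ν.restrict D]
      fun ξ => condLaw μ bnd ξ (cylinder y') * ENNReal.ofReal (weight μ y) := by
    refine ae_eq_of_forall_setLIntegral_eq_of_sigmaFinite ((hm y).mul_const _)
      ((hm y').mul_const _) fun B hB _ => ?_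
    rw [Measure.restrict_restrict hB, lintegral_mul_const _ (hm y), lintegral_mul_const _ (hm y'),
      hE y h0 _ (hB.inter hDm), hE y' h0' _ (hB.inter hDm), hset _ Set.inter_subset_right]
    ring
  have hw : ∀ y : Fin (n + 1) → G, 0 ≤ weight μ y := fun y =>
    Finset.prod_nonneg fun _ _ => measureReal_nonneg
  filter_upwards [(ae_restrict_iff' hDm).1 key] with ξ hξ _ _ hξD
  have := congrArg ENNReal.toReal (hξ hξD)
  rwa [ENNReal.toReal_mul, ENNReal.toReal_mul, ENNReal.toReal_ofReal (hw _),
    ENNReal.toReal_ofReal (hw _)] at this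

end Trajectory

/-! ### Trajectories of a collection, indexed by subsets of its choice times. -/

namespace Collection

variable {G : Type*} [Group G] [MeasurableSpace G] {μ : Measure G} {n : ℕ}

/-- At the end of any two trajectories of `q` the boundary point `ξ` looks the same, if the choices
between `a` and `1` are made where `a` fixes it. -/
lemma inv_smul_eq_of_mem_trajectories {X : Type*} [MulAction G X] {a : G} {J : Set X}
    (haJ : ∀ x ∉ J, a • x = x) {q : Collection μ n} {ξ : X}
    (hq : ∀ y ∈ q.trajectories a 1, ∀ j ∈ q.times, (y j.castSucc)⁻¹ • ξ ∉ J)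
    {y y' : Fin (n + 1) → G} (hy : y ∈ q.trajectories a 1) (hy' : y' ∈ q.trajectories a 1)
    (i : Fin (n + 1)) : (y i)⁻¹ • ξ = (y' i)⁻¹ • ξ := by
  have key : ∀ z ∈ q.trajectories a 1, ∀ j ∈ q.times,
      (z j.succ)⁻¹ • ξ = (z j.castSucc)⁻¹ • ξ := by
    intro z hz j hj
    rcases hz.2.2 j hj with h | h
    · rw [h, mul_inv_rev, mul_smul, inv_smul_eq_iff, haJ _ (hq z hz j hj)]
    · rw [h, mul_one]
  induction i using Fin.induction with
  | zero => rw [hy.1, hy'.1]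
  | succ j ih =>
    by_cases hj : j ∈ q.times
    · rw [key y hy j hj, key y' hy' j hj, ih]
    · rw [hy.2.1 ⟨j, hj⟩, hy'.2.1 ⟨j, hj⟩, mul_inv_rev, mul_inv_rev, mul_smul, mul_smul, ih]

/-- The increments of the trajectory of `q` in which the step `a` is chosen at the times in `S`. -/
def word (q : Collection μ n) (a b : G) (S : Finset (Fin n)) (j : Fin n) : G :=
  if h : j ∈ q.times then if j ∈ S then a else b else q.step ⟨j, h⟩

lemma mem_trajectories_iff {a b : G} {q : Collection μ n} {y : Fin (n + 1) → G} :
    y ∈ q.trajectories a b ↔ ∃ S ∈ q.times.powerset, Fin.partialProd (q.word a b S) = y := by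
  classical
  constructor
  · intro hy
    refine ⟨{j ∈ q.times | y j.succ = y j.castSucc * a},
      Finset.mem_powerset.2 (Finset.filter_subset _ _), ?_⟩
    funext i
    induction i using Fin.induction with
    | zero => rw [Fin.partialProd_zero, hy.1]
    | succ j ih =>
      rw [Fin.partialProd_succ, ih, word]
      by_cases hj : j ∈ q.times
      · simp only [hj, dif_pos, Finset.mem_filter, true_and]
        split_ifs with h
        · exact h.symm
        · exact ((hy.2.2 j hj).resolve_left h).symm
      · rw [dif_neg hj, hy.2.1 ⟨j, hj⟩]
  · rintro ⟨S, -, rfl⟩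
    refine ⟨Fin.partialProd_zero _, fun j => ?_, fun j hj => ?_⟩
    · rw [Fin.partialProd_succ, word, dif_neg j.2]
    · rw [Fin.partialProd_succ, word, dif_pos hj]
      split_ifs
      exacts [Or.inl rfl, Or.inr rfl]

lemma partialProd_word_injOn {a b : G} (hab : a ≠ b) (q : Collection μ n) :
    Set.InjOn (fun S => Fin.partialProd (q.word a b S)) q.times.powerset := by
  intro S hS S' hS' h
  rw [Finset.mem_coe, Finset.mem_powerset] at hS hS'
  have hw : q.word a b S = q.word a b S' := by
    funext j
    have := congrFun h
    simp only at this
    rw [← Fin.partialProd_right_inv (q.word a b S), ← Fin.partialProd_right_inv (q.word a b S'),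
      this, this]
  ext j
  by_cases hj : j ∈ q.times
  · have := congrFun hw j
    simp only [word, dif_pos hj] at this
    split_ifs at this <;> simp_all
  · exact ⟨fun h => absurd (hS h) hj, fun h => absurd (hS' h) hj⟩

/-- `V` is the probability of the prescribed steps, common to all trajectories of `q` and positive
because these steps lie in the support. -/
lemma exists_weight_eq [IsProbabilityMeasure μ] (a b : G) (q : Collection μ n) :
    ∃ V : ℝ, 0 < V ∧ ∀ S ∈ q.times.powerset, weight μ (Fin.partialProd (q.word a b S))
      = V * (μ.real {a} ^ S.card * μ.real {b} ^ (q.times.card - S.card)) := by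
  classical
  refine ⟨∏ j : Fin n, if h : j ∈ q.times then 1 else μ.real {q.step ⟨j, h⟩},
    Finset.prod_pos fun j _ => ?_, fun S hS => ?_⟩
  · split_ifs with h
    · exact one_pos
    · exact ENNReal.toReal_pos (q.step_mem _) (measure_ne_top _ _)
  · have hS' := Finset.mem_powerset.1 hS
    have h1 : μ.real {a} ^ S.card * μ.real {b} ^ (q.times.card - S.card)
        = ∏ j : Fin n, if j ∈ q.times then (if j ∈ S then μ.real {a} else μ.real {b}) else 1 := by
      rw [Finset.prod_ite_mem, Finset.univ_inter, Finset.prod_ite, Finset.prod_const,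
        Finset.prod_const, Finset.filter_mem_eq_inter, Finset.inter_eq_right.2 hS',
        ← Finset.sdiff_eq_filter, Finset.card_sdiff_of_subset hS']
    rw [h1, weight, ← Finset.prod_mul_distrib]
    refine Finset.prod_congr rfl fun j _ => ?_
    rw [Fin.partialProd_right_inv, word]
    split_ifs <;> simp

lemma iUnion_cylinder_eq (a b : G) (q : Collection μ n) :
    ⋃ y ∈ q.trajectories a b, cylinder y
      = ⋃ S ∈ q.times.powerset, cylinder (Fin.partialProd (q.word a b S)) := by
  ext w
  simp only [Set.mem_iUnion, mem_trajectories_iff, exists_prop]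
  constructor
  · rintro ⟨_, ⟨S, hS, rfl⟩, hw⟩
    exact ⟨S, hS, hw⟩
  · rintro ⟨S, hS, hw⟩
    exact ⟨_, ⟨S, hS, rfl⟩, hw⟩

lemma pairwiseDisjoint_cylinder {a b : G} (hab : a ≠ b) (q : Collection μ n) :
    (q.times.powerset : Set (Finset (Fin n))).PairwiseDisjoint
      fun S => cylinder (Fin.partialProd (q.word a b S)) := by
  intro S hS S' hS' hne
  refine Set.disjoint_left.2 fun w hw hw' => hne (q.partialProd_word_injOn hab hS hS' ?_)
  exact eq_of_mem_cylinder (by simp [Fin.partialProd_zero]) hw hw'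

instance countable [Countable G] : Countable (Collection μ n) := by
  let f : Collection μ n → Σ t : Finset (Fin n), ({j : Fin n // j ∉ t} → G) := fun q => ⟨q.1, q.2⟩
  refine Function.Injective.countable (f := f) ?_
  rintro ⟨t, s, h⟩ ⟨t', s', h'⟩ heq
  simp only [f, Sigma.mk.injEq] at heq
  obtain ⟨rfl, h⟩ := heq
  simp_all

end Collection

/-- Writing entropy as expected information allows it to be localized to disjoint events. -/
lemma tsum_entropyTerm_eq_lintegral {G : Type*} [Countable G] [MeasurableSpace G]
    [DiscreteMeasurableSpace G] (P : Measure (ℕ → G)) [IsProbabilityMeasure P] (n : ℕ) :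
    ∑' g, entropyTerm (P {w | w n = g}) = ∫⁻ w, info (P {w' | w' n = w n}) ∂P := by
  have hn : Measurable fun w : ℕ → G => w n := measurable_pi_apply n
  have h := lintegral_map (μ := P) (f := fun g => info (P {w' | w' n = g}))
    (Measurable.of_discrete) hn
  rw [← h, lintegral_countable']
  refine tsum_congr fun g => ?_
  rw [Measure.map_apply hn (measurableSet_singleton g), entropyTerm_eq_mul_info prob_le_one,
    mul_comm]
  rfl

/-- The larger of the conditional probabilities of the steps `a` and `b`, given that one of them
is made. -/
noncomputable def choiceBound {G : Type*} [MeasurableSpace G] (μ : Measure G) (a b : G) : ℝ :=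
  max (μ.real {a}) (μ.real {b}) / (μ.real {a} + μ.real {b})

lemma choiceBound_pos {G : Type*} [MeasurableSpace G] {μ : Measure G}
    [IsProbabilityMeasure μ] {a b : G} (ha : μ {a} ≠ 0) (hb : μ {b} ≠ 0) : 0 < choiceBound μ a b := by
  have ha' : 0 < μ.real {a} := ENNReal.toReal_pos ha (measure_ne_top _ _)
  have hb' : 0 < μ.real {b} := ENNReal.toReal_pos hb (measure_ne_top _ _)
  exact div_pos (lt_max_of_lt_left ha') (by positivity)

lemma choiceBound_lt_one {G : Type*} [MeasurableSpace G] {μ : Measure G}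
    [IsProbabilityMeasure μ] {a b : G} (ha : μ {a} ≠ 0) (hb : μ {b} ≠ 0) : choiceBound μ a b < 1 := by
  have ha' : 0 < μ.real {a} := ENNReal.toReal_pos ha (measure_ne_top _ _)
  have hb' : 0 < μ.real {b} := ENNReal.toReal_pos hb (measure_ne_top _ _)
  rw [choiceBound, div_lt_one (by positivity)]
  exact max_lt (by linarith) (by linarith)

/-! ### The entropy lower bound from satisfactory collections. -/

section Positivity

variable {G : Type*} [Group G] [MeasurableSpace G] {μ : Measure G} [IsProbabilityMeasure μ]

variable {n : ℕ}

namespace Collection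

/-- Summing the proportionality over all subsets `S'` makes the weights add up to `V * (μ(a) + μ(b))
^ k` by the binomial theorem; a single weight is at most `V * max (μ(a)) (μ(b)) ^ k`. -/
lemma measureReal_cylinder_le {a b : G} (ha : μ {a} ≠ 0) (hb : μ {b} ≠ 0)
    {P : Measure (ℕ → G)} [IsProbabilityMeasure P] {q : Collection μ n}
    (hP : ∀ y ∈ q.trajectories a b, ∀ y' ∈ q.trajectories a b,
      P.real (cylinder y) * weight μ y' = P.real (cylinder y') * weight μ y)
    {S : Finset (Fin n)} (hS : S ∈ q.times.powerset) :
    P.real (cylinder (Fin.partialProd (q.word a b S))) ≤ choiceBound μ a b ^ q.times.card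
      * ∑ S' ∈ q.times.powerset, P.real (cylinder (Fin.partialProd (q.word a b S'))) := by
  obtain ⟨V, hV, hw⟩ := q.exists_weight_eq a b
  have ha' : 0 < μ.real {a} := ENNReal.toReal_pos ha (measure_ne_top _ _)
  have hb' : 0 < μ.real {b} := ENNReal.toReal_pos hb (measure_ne_top _ _)
  have hmem : ∀ S ∈ q.times.powerset, Fin.partialProd (q.word a b S) ∈ q.trajectories a b :=
    fun S hS => mem_trajectories_iff.2 ⟨S, hS, rfl⟩
  have hsum := Finset.sum_congr rfl fun S' hS' => hP _ (hmem S hS) _ (hmem S' hS')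
  rw [← Finset.mul_sum, ← Finset.sum_mul, hw S hS, Finset.sum_congr rfl fun S' hS' => hw S' hS',
    ← Finset.mul_sum, Finset.sum_pow_mul_eq_add_pow] at hsum
  set M := ∑ S' ∈ q.times.powerset, P.real (cylinder (Fin.partialProd (q.word a b S'))) with hM
  have hM0 : 0 ≤ M := Finset.sum_nonneg fun _ _ => measureReal_nonneg
  have hcard := Finset.card_le_card (Finset.mem_powerset.1 hS)
  have hle : μ.real {a} ^ S.card * μ.real {b} ^ (q.times.card - S.card)
      ≤ max (μ.real {a}) (μ.real {b}) ^ q.times.card := by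
    calc _ ≤ max (μ.real {a}) (μ.real {b}) ^ S.card
          * max (μ.real {a}) (μ.real {b}) ^ (q.times.card - S.card) := by
          gcongr
          exacts [le_max_left _ _, le_max_right _ _]
      _ = _ := by rw [← pow_add]; congr 1; omega
  rw [choiceBound, div_pow, div_mul_eq_mul_div, le_div_iff₀ (by positivity)]
  refine le_of_mul_le_mul_left ?_ hV
  calc _ = M * (V * (μ.real {a} ^ S.card * μ.real {b} ^ (q.times.card - S.card))) := by
        rw [← hsum]; ring
    _ ≤ M * (V * max (μ.real {a}) (μ.real {b}) ^ q.times.card) := by gcongr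
    _ = _ := by ring

variable [Countable G] [DiscreteMeasurableSpace G]

/-- Given that a trajectory follows a satisfactory collection `q`, the position at time `n` carries
an amount of information proportional to the number of choices in `q`. -/
lemma le_setLIntegral_info (hn : 0 < n) {a b : G} (hab : a ≠ b) (ha : μ {a} ≠ 0) (hb : μ {b} ≠ 0)
    {P : Measure (ℕ → G)} [IsProbabilityMeasure P] {q : Collection μ n} (hq : q.Satisfactory a b)
    (hP : ∀ y ∈ q.trajectories a b, ∀ y' ∈ q.trajectories a b,
      P.real (cylinder y) * weight μ y' = P.real (cylinder y') * weight μ y) :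
    ENNReal.ofReal (q.times.card * -Real.log (choiceBound μ a b))
        * P (⋃ y ∈ q.trajectories a b, cylinder y)
      ≤ ∫⁻ w in ⋃ y ∈ q.trajectories a b, cylinder y, info (P {w' | w' n = w n}) ∂P := by
  set y : Finset (Fin n) → Fin (n + 1) → G := fun S => Fin.partialProd (q.word a b S) with hy
  have hmem : ∀ S ∈ q.times.powerset, y S ∈ q.trajectories a b :=
    fun S hS => mem_trajectories_iff.2 ⟨S, hS, rfl⟩
  -- `m S` is the full mass of an endpoint, including trajectories outside `q`. Satisfactoriness
  -- makes the endpoints distinct, so these masses sum to at most 1.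
  set m : Finset (Fin n) → ℝ := fun S => P.real {w | w n = y S (Fin.last n)} with hm
  have hm1 : ∀ S, m S ≤ 1 := fun S => measureReal_le_one
  have hsum : ∑ S ∈ q.times.powerset, m S ≤ 1 := by
    rw [← measureReal_biUnion_finset (fun S hS S' hS' hne => ?_)
      (fun S _ => measurableSet_position n _)]
    · exact measureReal_le_one
    · refine Set.disjoint_left.2 fun w hw hw' => hne ?_
      by_contra hSS'
      exact hq _ (hmem S hS) _ (hmem S' hS')
        (fun h => hSS' (q.partialProd_word_injOn hab hS hS' h)) (hw.symm.trans hw')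
  have hθ := choiceBound_pos ha hb
  have gibbs := sum_mul_neg_log_le q.times.powerset (P := fun S => P.real (cylinder (y S)))
    (m := m) (t := choiceBound μ a b ^ q.times.card) (by positivity) hsum
    (fun _ _ => measureReal_nonneg)
    (fun S _ => measureReal_mono fun w hw => apply_eq_of_mem_cylinder hn hw)
    (fun S hS => measureReal_cylinder_le ha hb hP hS)
  rw [Real.log_pow, ← mul_neg] at gibbs
  have hpos : 0 ≤ (q.times.card : ℝ) * -Real.log (choiceBound μ a b) :=
    mul_nonneg (Nat.cast_nonneg _) (neg_nonneg.2
      (Real.log_nonpos hθ.le (choiceBound_lt_one ha hb).le))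
  have hdisj := q.pairwiseDisjoint_cylinder hab
  have hint : ∀ S, ∫⁻ w in cylinder (y S), info (P {w' | w' n = w n}) ∂P
      = ENNReal.ofReal (P.real (cylinder (y S)) * -Real.log (m S)) := by
    intro S
    rw [setLIntegral_congr_fun (g := fun _ => info (P {w' | w' n = y S (Fin.last n)}))
      (measurableSet_cylinder _) (fun w hw => ?_), setLIntegral_const,
      ENNReal.ofReal_mul measureReal_nonneg, ofReal_measureReal, mul_comm]
    · rfl
    · simp only [apply_eq_of_mem_cylinder hn hw]
  rw [iUnion_cylinder_eq, lintegral_biUnion_finset hdisj (fun S _ => measurableSet_cylinder _),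
    measure_biUnion_finset hdisj (fun S _ => measurableSet_cylinder _),
    Finset.sum_congr rfl fun S _ => hint S,
    ← ENNReal.ofReal_sum_of_nonneg fun S _ => mul_nonneg measureReal_nonneg
      (neg_nonneg.2 (Real.log_nonpos measureReal_nonneg (hm1 S)))]
  have hM : ∑ S ∈ q.times.powerset, P (cylinder (Fin.partialProd (q.word a b S)))
      = ENNReal.ofReal (∑ S ∈ q.times.powerset, P.real (cylinder (y S))) := by
    rw [ENNReal.ofReal_sum_of_nonneg fun _ _ => measureReal_nonneg]
    exact Finset.sum_congr rfl fun S _ => (ofReal_measureReal).symm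
  rw [hM, ← ENNReal.ofReal_mul hpos, mul_comm]
  exact ENNReal.ofReal_le_ofReal gibbs

end Collection

variable [Countable G] [DiscreteMeasurableSpace G]

/-- Information is nonnegative, so the part outside the collections can be dropped; the
contributions of distinct collections live on disjoint events and add. -/
lemma le_tsum_entropyTerm (hn : 0 < n) {a b : G} (hab : a ≠ b) (ha : μ {a} ≠ 0) (hb : μ {b} ≠ 0)
    {P : Measure (ℕ → G)} [IsProbabilityMeasure P] {A : Set (Collection μ n)} {c : ℝ}
    (hA : ∀ q ∈ A, c * n ≤ q.times.card) (hsat : ∀ q ∈ A, q.Satisfactory a b)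
    (hdisj : ∀ q₁ ∈ A, ∀ q₂ ∈ A, q₁ ≠ q₂ → ∀ y₁ ∈ q₁.trajectories a b,
      ∀ y₂ ∈ q₂.trajectories a b, cylinder y₁ ∩ cylinder y₂ = ∅)
    (hP : ∀ q ∈ A, ∀ y ∈ q.trajectories a b, ∀ y' ∈ q.trajectories a b,
      P.real (cylinder y) * weight μ y' = P.real (cylinder y') * weight μ y) :
    ENNReal.ofReal (c * n * -Real.log (choiceBound μ a b))
        * P (⋃ q ∈ A, ⋃ y ∈ q.trajectories a b, cylinder y)
      ≤ ∑' g, entropyTerm (P {w | w n = g}) := by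
  have hlog : 0 ≤ -Real.log (choiceBound μ a b) := neg_nonneg.2
    (Real.log_nonpos (choiceBound_pos ha hb).le (choiceBound_lt_one ha hb).le)
  have hmeas : ∀ q ∈ A, MeasurableSet (⋃ y ∈ q.trajectories a b, cylinder y) := fun q _ =>
    MeasurableSet.biUnion (Set.to_countable _) fun y _ => measurableSet_cylinder y
  have hd : A.PairwiseDisjoint fun q => ⋃ y ∈ q.trajectories a b, cylinder y := by
    intro q₁ h₁ q₂ h₂ hne
    refine Set.disjoint_left.2 fun w hw hw' => ?_
    simp only [Set.mem_iUnion, exists_prop] at hw hw'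
    obtain ⟨y₁, hy₁, hw₁⟩ := hw
    obtain ⟨y₂, hy₂, hw₂⟩ := hw'
    exact (hdisj q₁ h₁ q₂ h₂ hne y₁ hy₁ y₂ hy₂).subset ⟨hw₁, hw₂⟩
  rw [tsum_entropyTerm_eq_lintegral P n, measure_biUnion (Set.to_countable A) hd hmeas]
  refine le_trans ?_ (setLIntegral_le_lintegral
    (⋃ q ∈ A, ⋃ y ∈ q.trajectories a b, cylinder y) _)
  rw [lintegral_biUnion (Set.to_countable A) hmeas hd, ← ENNReal.tsum_mul_left]
  refine ENNReal.tsum_le_tsum fun q => ?_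
  refine le_trans ?_ (q.1.le_setLIntegral_info hn hab ha hb (hsat q q.2) (hP q q.2))
  gcongr
  exact hA q q.2

end Positivity

/-- Fekete's lemma for a sequence in `[0, ∞]` bounded below by a linear function. -/
theorem exists_tendsto_div_of_subadditive {u : ℕ → ENNReal} (hu : ∀ m n, u (m + n) ≤ u m + u n)
    (hfin : ∀ n, 0 < n → u n ≠ ⊤) {δ : ℝ} (hδ : 0 < δ)
    (hlow : ∀ n : ℕ, 0 < n → ENNReal.ofReal (δ * n) ≤ u n) :
    ∃ h : ℝ, 0 < h ∧ Tendsto (fun n : ℕ => u n / n) atTop (𝓝 (ENNReal.ofReal h)) := by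
  -- `u 0` may be infinite; the value 0 there makes subadditivity trivial when an argument is 0 and
  -- does not affect the limit.
  set v : ℕ → ℝ := fun n => if n = 0 then 0 else (u n).toReal with hv
  have hv0 : ∀ n, 0 < n → v n = (u n).toReal := fun n hn => if_neg hn.ne'
  have hsub : Subadditive v := by
    intro m n
    rcases Nat.eq_zero_or_pos m with rfl | hm
    · simp [hv]
    rcases Nat.eq_zero_or_pos n with rfl | hn
    · simp [hv]
    rw [hv0 m hm, hv0 n hn, hv0 _ (by omega), ← ENNReal.toReal_add (hfin m hm) (hfin n hn)]
    exact ENNReal.toReal_mono (ENNReal.add_ne_top.2 ⟨hfin m hm, hfin n hn⟩) (hu m n)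
  have hvn : ∀ n, 0 ≤ v n := fun n => by
    simp only [hv]; split_ifs
    exacts [le_rfl, ENNReal.toReal_nonneg]
  have hlim := hsub.tendsto_lim ⟨0, by rintro _ ⟨n, rfl⟩; have := hvn n; positivity⟩
  refine ⟨hsub.lim, hδ.trans_le (ge_of_tendsto hlim ?_), ?_⟩
  · filter_upwards [eventually_gt_atTop 0] with n hn
    have hn' : (0 : ℝ) < n := Nat.cast_pos.2 hn
    rw [le_div_iff₀ hn', hv0 n hn]
    exact (ENNReal.ofReal_le_iff_le_toReal (hfin n hn)).1 (hlow n hn)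
  · refine ((ENNReal.continuous_ofReal.tendsto _).comp hlim).congr' ?_
    filter_upwards [eventually_gt_atTop 0] with n hn
    rw [Function.comp_apply, hv0 n hn, ENNReal.ofReal_div_of_pos (Nat.cast_pos.2 hn),
      ENNReal.ofReal_toReal (hfin n hn), ENNReal.ofReal_natCast]

end RandomWalk

theorem theorem3p2 {G : Type*} [Group G] [Countable G] [MeasurableSpace G]
    [DiscreteMeasurableSpace G] (μ : Measure G) [IsProbabilityMeasure μ]
    (hμ : RandomWalk.shannonEntropy μ < ⊤)
    {X : Type*} [MeasurableSpace X] [StandardBorelSpace X] [MulAction G X]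
    [MeasurableConstSMul G X] (ν : Measure X) [IsProbabilityMeasure ν] (bnd : (ℕ → G) → X)
    (hX : RandomWalk.IsBoundary μ ν bnd)
    (a : G) (ha : a ≠ 1) (haμ : μ {a} ≠ 0) (heμ : μ {(1 : G)} ≠ 0)
    (J : Set X) (hJ : MeasurableSet J) (haJ : ∀ x ∉ J, a • x = x)
    (p c : ℝ) (hp : 0 < p) (hc : 0 < c)
    (H : ∀ n : ℕ, 0 < n → ∃ Ξ : Set X, MeasurableSet Ξ ∧ p ≤ ν.real Ξ ∧
      ∀ᵐ ξ ∂ν, ξ ∈ Ξ → ∃ A : Set (RandomWalk.Collection μ n),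
        (∀ q ∈ A, c * n ≤ q.times.card) ∧
        (∀ q ∈ A, q.Satisfactory a 1) ∧
        (∀ q₁ ∈ A, ∀ q₂ ∈ A, q₁ ≠ q₂ →
          ∀ y₁ ∈ q₁.trajectories a 1, ∀ y₂ ∈ q₂.trajectories a 1,
            RandomWalk.cylinder y₁ ∩ RandomWalk.cylinder y₂ = ∅) ∧
        p ≤ (RandomWalk.condLaw μ bnd ξ).real
          (⋃ q ∈ A, ⋃ y ∈ q.trajectories a 1, RandomWalk.cylinder y) ∧
        (∀ q ∈ A, ∀ y ∈ q.trajectories a 1, ∀ j ∈ q.times, (y j.castSucc)⁻¹ • ξ ∉ J)) :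
    ∃ h : ℝ, 0 < h ∧
      Tendsto (fun n : ℕ => RandomWalk.meanCondEntropy μ ν bnd n / n) atTop
        (𝓝 (ENNReal.ofReal h)) := by
  have hlog : 0 < -Real.log (RandomWalk.choiceBound μ a 1) := neg_pos.2
    (Real.log_neg (RandomWalk.choiceBound_pos haμ heμ) (RandomWalk.choiceBound_lt_one haμ heμ))
  refine RandomWalk.exists_tendsto_div_of_subadditive hX.meanCondEntropy_add_le (fun n hn => ?_)
    -- One factor `p` is the conditional probability of following a collection, the other the mass
    -- of `Ξ`.
    (δ := c * -Real.log (RandomWalk.choiceBound μ a 1) * p * p) (by positivity) fun n hn => ?_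
  · obtain ⟨m, rfl⟩ := Nat.exists_eq_succ_of_ne_zero hn.ne'
    exact ((hX.meanCondEntropy_le m).trans_lt
      (ENNReal.mul_lt_top (ENNReal.natCast_lt_top _) hμ)).ne
  · obtain ⟨Ξ, hΞ, hpΞ, hA⟩ := H n hn
    set L : ℝ := c * n * -Real.log (RandomWalk.choiceBound μ a 1) with hL
    have hL0 : 0 ≤ L := by positivity
    calc ENNReal.ofReal (c * -Real.log (RandomWalk.choiceBound μ a 1) * p * p * n)
        = ENNReal.ofReal (L * p) * ENNReal.ofReal p := by
          rw [← ENNReal.ofReal_mul (by positivity), hL]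
          congr 1
          ring
      _ ≤ ENNReal.ofReal (L * p) * ν Ξ := by
          gcongr
          exact ENNReal.ofReal_le_of_le_toReal hpΞ
      _ = ∫⁻ _ in Ξ, ENNReal.ofReal (L * p) ∂ν := (setLIntegral_const _ _).symm
      _ ≤ ∫⁻ ξ in Ξ, RandomWalk.condEntropy μ bnd n ξ ∂ν := by
          refine setLIntegral_mono_ae' hΞ ?_
          filter_upwards [hA, hX.ae_condLaw_cylinder hn] with ξ hξ hcyl hξΞ
          obtain ⟨A, h1, h2, h3, h4, h5⟩ := hξ hξΞ
          have h := RandomWalk.le_tsum_entropyTerm hn ha haμ heμ h1 h2 h3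
            (P := RandomWalk.condLaw μ bnd ξ) fun q hq y hy y' hy' => hcyl y y' hy.1 hy'.1
              (RandomWalk.Collection.inv_smul_eq_of_mem_trajectories haJ (h5 q hq) hy hy' _)
          refine le_trans ?_ h
          rw [ENNReal.ofReal_mul hL0]
          gcongr
          exact ENNReal.ofReal_le_of_le_toReal h4
      _ ≤ RandomWalk.meanCondEntropy μ ν bnd n := setLIntegral_le_lintegral _ _
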